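/- Let $V=\{1,\dots,p\}$ and let $F:2^V\to\mathbb{R}$ be submodular with $F(\varnothing)=F(V)=0$ and $F(A)>0$ for every $A\subset V$ with $A\neq\varnothing,V$. Let $f(w)=\int_{\mathbb{R}}F(\{k: w_k\geqslant\alpha\})\,d\alpha$ be its Lovász extension on $\mathbb{R}^p$, and let $\mathcal{U}=\{w\in\mathbb{R}^p: f(w)\leqslant 1\}$. A lattice is a family $\mathcal{D}\subset 2^V$ that contains $\varnothing$ and $V$ and is closed under union and intersection. The differences $T\setminus S$, where $S\subsetneq T$ are members of $\mathcal{D}$ with no member of $\mathcal{D}$ strictly between them, form a partition $\Pi(\mathcal{D})=\{A_1,\dots,A_m\}$ of $V$ (its elements are called blocks). It is partially ordered by: $A_j\succcurlyeq A_i$ if every member of $\mathcal{D}$ that contains $A_j$ contains $A_i$. (The members of $\mathcal{D}$ are thus the unions of the down-closed sets of blocks.) The ancestors of $A_j$ are the blocks $A_i\neq A_j$ with $A_j\succcurlyeq A_i$. A set $A$ is inseparable for a set-function $H$ if there is no partition of $A$ into two non-empty sets $B$, $C$ with $H(A)=H(B)+H(C)$. Let $\mathcal{U}^\circ_{\mathcal{D}}$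 be the set of $w\in\mathbb{R}^p$ that are constant on each block, with value $v_j$ on $A_j$, and satisfy $v_i>v_j$ whenever $A_i$ is an ancestor of $A_j$. Then the non-empty relative interiors of the faces $G\neq\mathcal{U}$ of $\mathcal{U}$ are exactly the sets $\mathcal{U}^\circ_{\mathcal{D}}\cap\{f=1\}$, where $\mathcal{D}\neq\{\varnothing,V\}$ is a lattice such that (i) $F(A)+F(B)=F(A\cup B)+F(A\cap B)$ for all $A,B\in\mathcal{D}$; (ii) for every $j$, the block $A_j$ is inseparable for $C\mapsto F(B_{j-1}\cup C)-F(B_{j-1})$, where $B_{j-1}$ denotes the union of the ancestors of $A_j$; (iii) $\mathcal{D}$ is maximal for inclusion among the lattices that have the same unordered partition and satisfy (i) and (ii). Moreover, the relative interior of the remaining face, $\mathcal{U}$ itself, is $\{f<1\}$. -/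

import Mathlib

open MeasureTheory

section Submodular

variable {V : Type*} [Fintype V] [DecidableEq V]

/-- The set-function `F` is submodular. -/
def IsSubmodular (F : Finset V → ℝ) : Prop :=
  ∀ A B : Finset V, F (A ∪ B) + F (A ∩ B) ≤ F A + F B

/-- The Lovász extension `f(w) = ∫ F({w ≥ α}) dα` of a set-function `F` that vanishes at the
empty set and at the full set (the integrand is then a step function of bounded support). -/
noncomputable def lovasz (F : Finset V → ℝ) (w : V → ℝ) : ℝ :=
  ∫ α : ℝ, F (Finset.univ.filter (fun k => α ≤ w k))

/-- The unit ball `U = {f ≤ 1}`. -/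
def unitBall (F : Finset V → ℝ) : Set (V → ℝ) := {w | lovasz F w ≤ 1}

/-- A face of a convex set `C`: a convex subset `G` such that every segment of `C` with a relative
interior point in `G` lies in `G`. (For polyhedra these are the intersections with supporting
hyperplanes, together with `∅` and `C`.) -/
def IsFace (C G : Set (V → ℝ)) : Prop := Convex ℝ G ∧ IsExtreme ℝ C G

/-- `A` is inseparable for `H`: there is no partition of `A` into two non-empty sets `B`, `C`
with `H A = H B + H C`. -/
def IsInseparable (H : Finset V → ℝ) (A : Finset V) : Prop :=
  ¬ ∃ B C : Finset V, B.Nonempty ∧ C.Nonempty ∧ Disjoint B C ∧ B ∪ C = A ∧ H A = H B + H C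

/-- A (distributive) lattice of subsets of `V` that contains the empty set and the full set. -/
structure IsSetLattice (D : Set (Finset V)) : Prop where
  empty_mem : ∅ ∈ D
  univ_mem : Finset.univ ∈ D
  union_mem : ∀ S ∈ D, ∀ T ∈ D, S ∪ T ∈ D
  inter_mem : ∀ S ∈ D, ∀ T ∈ D, S ∩ T ∈ D

/-- The unordered partition of `V` given by `D`: the differences `T \ S` of consecutive sets
`S ⊂ T` in the maximal chains of `D`, i.e. of pairs with no member of `D` strictly in between. -/
def blocks (D : Set (Finset V)) : Set (Finset V) :=
  {A | ∃ S ∈ D, ∃ T ∈ D, S ⊂ T ∧ (∀ R ∈ D, ¬ (S ⊂ R ∧ R ⊂ T)) ∧ A = T \ S}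

/-- `A'` is strictly lower than `A` in the poset of blocks of `D` (an ancestor of `A`): the blocks
differ and every member of `D` containing `A` contains `A'`. This is the order for which the
members of `D` are the unions of the ideals (down-closed sets) of blocks. -/
def IsAncestor (D : Set (Finset V)) (A' A : Finset V) : Prop :=
  A' ∈ blocks D ∧ A ∈ blocks D ∧ A' ≠ A ∧ ∀ T ∈ D, A ⊆ T → A' ⊆ T

open Classical in
/-- The union of all ancestors of the block `A`. -/
noncomputable def ancestorUnion (D : Set (Finset V)) (A : Finset V) : Finset V :=
  Finset.univ.filter (fun k => ∃ A', IsAncestor D A' A ∧ k ∈ A')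

/-- The restriction of `F` to `D` is modular. -/
def IsModularOn (F : Finset V → ℝ) (D : Set (Finset V)) : Prop :=
  ∀ A ∈ D, ∀ B ∈ D, F A + F B = F (A ∪ B) + F (A ∩ B)

/-- Every block `A` of `D` is inseparable for `C ↦ F (B ∪ C) - F B`, where `B` is the union of the
ancestors of `A`. -/
def HasInseparableBlocks (F : Finset V → ℝ) (D : Set (Finset V)) : Prop :=
  ∀ A ∈ blocks D,
    IsInseparable (fun C => F (ancestorUnion D A ∪ C) - F (ancestorUnion D A)) A

/-- `D` is a lattice satisfying (i) modularity of `F` on `D`, (ii) inseparability of the blocks and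
(iii) maximality, for inclusion, among the lattices with the same unordered partition that
satisfy (i) and (ii). -/
structure IsAllowedLattice (F : Finset V → ℝ) (D : Set (Finset V)) : Prop where
  isSetLattice : IsSetLattice D
  modular : IsModularOn F D
  inseparable : HasInseparableBlocks F D
  maximal : ∀ D' : Set (Finset V), IsSetLattice D' → blocks D' = blocks D →
    IsModularOn F D' → HasInseparableBlocks F D' → D ⊆ D' → D' = D

/-- The open cone attached to `D`: vectors `w` that are constant on every block `A` of `D`, with
value `v A`, and such that the value on a block is strictly smaller than on each of its
ancestors. Thus the level sets `{w ≥ α}` belong to `D`. -/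
def openCone (D : Set (Finset V)) : Set (V → ℝ) :=
  {w | ∃ v : Finset V → ℝ, (∀ A ∈ blocks D, ∀ k ∈ A, w k = v A) ∧
    ∀ A' A, IsAncestor D A' A → v A < v A'}

end Submodular

/-!
The minimal face of a convex set `C` at `x` consists of the `y ∈ C` such that the segment from `y`
to `x` can be prolonged within `C`; the relative interiors of faces are the classes of points with
the same minimal face. By the greedy algorithm, `f` is the support function of the base polytope
`B(F)`, and two points of `{f = 1}` have the same minimal face in `{f ≤ 1}` if and only if they
are maximized on the same face `M` of `B(F)`. A point `s` of `B(F)` lies on the face maximizing `w`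
exactly when all the superlevel sets of `w` are tight for `s`; so `M` is determined by the lattice
of the sets that are tight on all of `M`, and the points maximized exactly on `M` form the open cone
of this lattice.

The cuts of a level of `w` by a tight set are again tight. Inseparability of the blocks therefore
says that no jointly tight set cuts a block of `D`, and maximality that `D` contains all the jointly
tight sets.
-/

open Topology

section MinimalFace

variable {E : Type*}

section Module

variable [AddCommGroup E] [Module ℝ E] {C G : Set E} {x y : E}

/-- The points `y` of `C` such that the segment from `y` to `x` can be prolonged beyond `x` within
`C`. When `C` is convex and contains `x`, this is the smallest face of `C` that contains `x`. -/
def minimalFace (C : Set E) (x : E) : Set E :=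
  {y ∈ C | ∃ ε : ℝ, 0 < ε ∧ x + ε • (x - y) ∈ C}

theorem self_mem_minimalFace (hx : x ∈ C) : x ∈ minimalFace C x :=
  ⟨hx, 1, one_pos, by simpa using hx⟩

theorem add_smul_mem_of_le (hC : Convex ℝ C) (hx : x ∈ C) {v : E} {δ ε : ℝ}
    (h : x + ε • v ∈ C) (hδ : 0 < δ) (hδε : δ ≤ ε) : x + δ • v ∈ C := by
  have hε : 0 < ε := hδ.trans_le hδε
  have := hC.add_smul_mem hx h ⟨div_nonneg hδ.le hε.le, (div_le_one hε).2 hδε⟩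
  rwa [smul_smul, div_mul_cancel₀ _ hε.ne'] at this

theorem convex_minimalFace (hC : Convex ℝ C) (hx : x ∈ C) : Convex ℝ (minimalFace C x) := by
  rintro y ⟨hy, ε, hε, hyε⟩ z ⟨hz, δ, hδ, hzδ⟩ a b ha hb hab
  have hmin : 0 < min ε δ := lt_min hε hδ
  refine ⟨hC hy hz ha hb hab, min ε δ, hmin, ?_⟩
  have hcombo := hC (add_smul_mem_of_le hC hx hyε hmin (min_le_left _ _))
    (add_smul_mem_of_le hC hx hzδ hmin (min_le_right _ _)) ha hb hab
  convert hcombo using 1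
  obtain rfl : b = 1 - a := by linarith
  module

theorem isExtreme_minimalFace (hC : Convex ℝ C) : IsExtreme ℝ C (minimalFace C x) := by
  refine ⟨fun y hy => hy.1, ?_⟩
  rintro y hy z hz _ ⟨-, ε, hε, hq⟩ ⟨a, b, ha, hb, hab, rfl⟩
  refine ⟨hy, ε * a / (1 + ε * b), by positivity, ?_⟩
  have hcombo := hC hq hz (a := 1 / (1 + ε * b)) (b := ε * b / (1 + ε * b)) (by positivity)
    (by positivity) (by field_simp)
  convert hcombo using 1
  obtain rfl : b = 1 - a := by linarith
  match_scalars <;> field_simp <;> ring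

theorem minimalFace_subset_of_isExtreme (hG : IsExtreme ℝ C G) (hx : x ∈ G) :
    minimalFace C x ⊆ G := by
  rintro y ⟨hy, ε, hε, hq⟩
  refine hG.left_mem_of_mem_openSegment hy hq hx
    ⟨ε / (1 + ε), 1 / (1 + ε), by positivity, by positivity, by field_simp; ring, ?_⟩
  match_scalars <;> field_simp
  ring

end Module

variable [NormedAddCommGroup E] [NormedSpace ℝ E] {C G : Set E} {x : E}

theorem mem_intrinsicInterior_iff_mem_nhdsWithin :
    x ∈ intrinsicInterior ℝ C ↔ x ∈ affineSpan ℝ C ∧ C ∈ 𝓝[affineSpan ℝ C] x := by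
  rw [mem_intrinsicInterior]
  constructor
  · rintro ⟨y, hy, rfl⟩
    exact ⟨y.2, preimage_coe_mem_nhds_subtype.1 (mem_interior_iff_mem_nhds.1 hy)⟩
  · rintro ⟨hx, hC⟩
    exact ⟨⟨x, hx⟩, mem_interior_iff_mem_nhds.2 (preimage_coe_mem_nhds_subtype.2 hC), rfl⟩

theorem subset_minimalFace_of_mem_intrinsicInterior (hx : x ∈ intrinsicInterior ℝ C) :
    C ⊆ minimalFace C x := by
  intro y hy
  obtain ⟨hxspan, hnhds⟩ := mem_intrinsicInterior_iff_mem_nhdsWithin.1 hx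
  have htendsto : Filter.Tendsto (fun ε : ℝ => AffineMap.lineMap x y (-ε)) (𝓝[>] 0) (𝓝 x) := by
    have : Continuous fun ε : ℝ => AffineMap.lineMap x y (-ε) := by fun_prop
    simpa using (this.tendsto 0).mono_left nhdsWithin_le_nhds
  obtain ⟨ε, hmem, hε⟩ :=
    ((htendsto.eventually (mem_nhdsWithin_iff_eventually.1 hnhds)).and self_mem_nhdsWithin).exists
  refine ⟨hy, ε, hε, ?_⟩
  have := hmem (AffineMap.lineMap_mem _ hxspan (subset_affineSpan ℝ C hy))
  rw [AffineMap.lineMap_apply_module] at this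
  convert this using 1
  module

theorem eq_minimalFace_of_mem_intrinsicInterior (hG : IsExtreme ℝ C G)
    (hx : x ∈ intrinsicInterior ℝ G) : G = minimalFace C x := by
  refine Set.Subset.antisymm (fun y hy => ?_)
    (minimalFace_subset_of_isExtreme hG (intrinsicInterior_subset hx))
  obtain ⟨-, ε, hε, hq⟩ := subset_minimalFace_of_mem_intrinsicInterior hx hy
  exact ⟨hG.subset hy, ε, hε, hG.subset hq⟩

variable [FiniteDimensional ℝ E]

theorem mem_intrinsicInterior_of_subset_minimalFace (hC : Convex ℝ C) (hx : x ∈ C)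
    (h : C ⊆ minimalFace C x) : x ∈ intrinsicInterior ℝ C := by
  obtain ⟨y, hy⟩ := Set.Nonempty.intrinsicInterior hC ⟨x, hx⟩
  obtain ⟨-, ε, hε, hz⟩ := h (intrinsicInterior_subset hy)
  set z := x + ε • (x - y) with hz_def
  obtain ⟨-, hnhds⟩ := mem_intrinsicInterior_iff_mem_nhdsWithin.1 hy
  refine mem_intrinsicInterior_iff_mem_nhdsWithin.2 ⟨subset_affineSpan ℝ C hx, ?_⟩
  -- The homothety of centre `z` that maps `x` to `y` maps points near `x` to points near `y`.
  have hhomothety : Filter.Tendsto (AffineMap.homothety z ((1 + ε) / ε)) (𝓝 x) (𝓝 y) := by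
    have hxy : AffineMap.homothety z ((1 + ε) / ε) x = y := by
      rw [AffineMap.homothety_apply, vsub_eq_sub, vadd_eq_add, hz_def]
      match_scalars <;> field_simp <;> ring
    simpa only [hxy] using (AffineMap.homothety_continuous z ((1 + ε) / ε)).tendsto x
  rw [mem_nhdsWithin_iff_eventually]
  filter_upwards [hhomothety.eventually (mem_nhdsWithin_iff_eventually.1 hnhds)]
    with x' hx' hx'_span
  have hy' := hx' (AffineMap.lineMap_mem _ (subset_affineSpan ℝ C hz) hx'_span)
  have hcombo := hC hz hy' (a := 1 / (1 + ε)) (b := ε / (1 + ε)) (by positivity) (by positivity)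
    (by field_simp)
  convert hcombo using 1
  rw [AffineMap.homothety_apply, vsub_eq_sub, vadd_eq_add]
  match_scalars <;> field_simp <;> ring

theorem mem_intrinsicInterior_iff_minimalFace_eq (hC : Convex ℝ C) :
    x ∈ intrinsicInterior ℝ C ↔ x ∈ C ∧ minimalFace C x = C :=
  ⟨fun hx => ⟨intrinsicInterior_subset hx, Set.Subset.antisymm (fun _ hy => hy.1)
    (subset_minimalFace_of_mem_intrinsicInterior hx)⟩,
    fun h => mem_intrinsicInterior_of_subset_minimalFace hC h.1 h.2.superset⟩

theorem self_mem_intrinsicInterior_minimalFace (hC : Convex ℝ C) (hx : x ∈ C) :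
    x ∈ intrinsicInterior ℝ (minimalFace C x) := by
  refine mem_intrinsicInterior_of_subset_minimalFace (convex_minimalFace hC hx)
    (self_mem_minimalFace hx) ?_
  rintro y ⟨hy, ε, hε, hq⟩
  refine ⟨⟨hy, ε, hε, hq⟩, ε, hε, hq, ε⁻¹, inv_pos.2 hε, ?_⟩
  rwa [sub_add_cancel_left, smul_neg, inv_smul_smul₀ hε.ne', neg_sub, add_sub_cancel]

theorem mem_intrinsicInterior_minimalFace_iff (hC : Convex ℝ C) {y : E} :
    y ∈ intrinsicInterior ℝ (minimalFace C x) ↔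
      y ∈ C ∧ minimalFace C y = minimalFace C x := by
  constructor
  · intro hy
    exact ⟨(intrinsicInterior_subset hy).1,
      (eq_minimalFace_of_mem_intrinsicInterior (isExtreme_minimalFace hC) hy).symm⟩
  · rintro ⟨hy, heq⟩
    exact heq ▸ self_mem_intrinsicInterior_minimalFace hC hy

theorem setOf_intrinsicInterior_proper_face_eq (hC : Convex ℝ C) :
    {R : Set E | R.Nonempty ∧
        ∃ G, (Convex ℝ G ∧ IsExtreme ℝ C G) ∧ G ≠ C ∧ R = intrinsicInterior ℝ G} =
      {R | ∃ x ∈ C, minimalFace C x ≠ C ∧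
        R = {y ∈ C | minimalFace C y = minimalFace C x}} := by
  have hri (x : E) :
      intrinsicInterior ℝ (minimalFace C x) = {y ∈ C | minimalFace C y = minimalFace C x} :=
    Set.ext fun y => mem_intrinsicInterior_minimalFace_iff hC
  ext R
  constructor
  · rintro ⟨⟨x, hx⟩, G, ⟨-, hG⟩, hne, rfl⟩
    obtain rfl := eq_minimalFace_of_mem_intrinsicInterior hG hx
    exact ⟨x, (intrinsicInterior_subset hx).1, hne, hri x⟩
  · rintro ⟨x, hx, hne, rfl⟩
    exact ⟨⟨x, hx, rfl⟩, minimalFace C x, ⟨convex_minimalFace hC hx, isExtreme_minimalFace hC⟩,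
      hne, (hri x).symm⟩

end MinimalFace

section Superlevel

variable {V R : Type*} [Fintype V] [LinearOrder R] {w : V → R} {α : R} {k : V}

/-- The set `{w ≥ α}`; the Lovász extension of `F` at `w` integrates `F` over these sets. -/
def superlevel (w : V → R) (α : R) : Finset V :=
  Finset.univ.filter fun k => α ≤ w k

/-- The set `{w > α}`; when `α` is a value of `w`, it is the superlevel set preceding `{w ≥ α}`. -/
def strictSuperlevel (w : V → R) (α : R) : Finset V :=
  Finset.univ.filter fun k => α < w k

@[simp]
theorem mem_superlevel : k ∈ superlevel w α ↔ α ≤ w k := by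
  simp [superlevel]

@[simp]
theorem mem_strictSuperlevel : k ∈ strictSuperlevel w α ↔ α < w k := by
  simp [strictSuperlevel]

theorem lt_of_mem_superlevel {i j : V} (hi : i ∈ superlevel w α) (hj : j ∉ superlevel w α) :
    w j < w i :=
  (not_le.1 (mt mem_superlevel.2 hj)).trans_le (mem_superlevel.1 hi)

theorem lt_of_mem_strictSuperlevel {i j : V} (hi : i ∈ strictSuperlevel w α)
    (hj : j ∉ strictSuperlevel w α) : w j < w i :=
  (not_lt.1 (mt mem_strictSuperlevel.2 hj)).trans_lt (mem_strictSuperlevel.1 hi)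

theorem strictSuperlevel_subset_superlevel : strictSuperlevel w α ⊆ superlevel w α :=
  fun _ hk => mem_superlevel.2 (mem_strictSuperlevel.1 hk).le

theorem exists_eq_superlevel {A : Finset V} (hA : A.Nonempty)
    (h : ∀ i ∈ A, ∀ j ∉ A, w j < w i) : ∃ i ∈ A, A = superlevel w (w i) := by
  obtain ⟨i, hi, hmin⟩ := A.exists_min_image w hA
  refine ⟨i, hi, Finset.ext fun k => ⟨fun hk => mem_superlevel.2 (hmin k hk), fun hk => ?_⟩⟩
  by_contra hkA
  exact (h i hi k hkA).not_ge (mem_superlevel.1 hk)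

theorem eq_empty_or_exists_eq_superlevel {A : Finset V} (h : ∀ i ∈ A, ∀ j ∉ A, w j < w i) :
    A = ∅ ∨ ∃ α, A = superlevel w α :=
  A.eq_empty_or_nonempty.imp_right fun hA =>
    (exists_eq_superlevel hA h).elim fun i hi => ⟨w i, hi.2⟩

theorem exists_superlevel_eq_univ (w : V → ℝ) : ∃ α, superlevel w α = Finset.univ := by
  obtain ⟨a, ha⟩ := (Set.finite_range w).bddBelow
  exact ⟨a, Finset.eq_univ_of_forall fun k => mem_superlevel.2 (ha ⟨k, rfl⟩)⟩

theorem superlevel_induction {P : Finset V → Prop} (empty : P ∅)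
    (step : ∀ i, P (strictSuperlevel w (w i)) → P (superlevel w (w i))) (α : R) :
    P (superlevel w α) := by
  suffices hupper : ∀ A : Finset V, (∀ i ∈ A, ∀ j ∉ A, w j < w i) → P A from
    hupper _ fun _ hi _ hj => lt_of_mem_superlevel hi hj
  intro A
  induction A using Finset.strongInduction with
  | H A ih =>
    intro hA
    obtain rfl | hne := A.eq_empty_or_nonempty
    · exact empty
    obtain ⟨i, -, rfl⟩ := exists_eq_superlevel hne hA
    have hlt : strictSuperlevel w (w i) ⊂ superlevel w (w i) :=
      (Finset.ssubset_iff_of_subset strictSuperlevel_subset_superlevel).2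
        ⟨i, by simp, by simp⟩
    exact step i (ih _ hlt fun k hk j hj => lt_of_mem_strictSuperlevel hk hj)

theorem eventually_superlevel_eq [TopologicalSpace R] [OrderTopology R] (w : V → R) (α : R) :
    ∀ᶠ β in 𝓝[≤] α, superlevel w β = superlevel w α := by
  have hsep : ∀ᶠ β in 𝓝[≤] α, ∀ k, w k < α → w k < β :=
    Filter.eventually_all.2 fun k => Filter.eventually_imp_distrib_left.2 fun hk =>
      (eventually_gt_nhds hk).filter_mono nhdsWithin_le_nhds
  filter_upwards [hsep, self_mem_nhdsWithin] with β hβ hβα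
  ext k
  simp only [mem_superlevel]
  exact ⟨fun hk => not_lt.1 fun hlt => (hβ k hlt).not_ge hk, hβα.trans⟩

end Superlevel

theorem exists_pos_add_smul_lt {V : Type*} [Finite V] (u v : V → ℝ) :
    ∃ ε : ℝ, 0 < ε ∧ ∀ i j, u i < u j → (u + ε • v) i < (u + ε • v) j := by
  have hcont (k : V) : Filter.Tendsto (fun ε : ℝ => (u + ε • v) k) (𝓝[>] 0) (𝓝 (u k)) := by
    have : Continuous fun ε : ℝ => u k + ε * v k := by fun_prop
    simpa using (this.tendsto 0).mono_left nhdsWithin_le_nhds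
  have hlt : ∀ᶠ ε : ℝ in 𝓝[>] 0, ∀ i j, u i < u j → (u + ε • v) i < (u + ε • v) j :=
    Filter.eventually_all.2 fun i => Filter.eventually_all.2 fun j =>
      Filter.eventually_imp_distrib_left.2 fun hij => (hcont i).eventually_lt (hcont j) hij
  obtain ⟨ε, hε, hpos⟩ := (hlt.and self_mem_nhdsWithin).exists
  exact ⟨ε, hpos, hε⟩

section Lovasz

variable {V : Type*} [Fintype V] {F G : Finset V → ℝ}

theorem lovasz_eq_integral_superlevel (F : Finset V → ℝ) (w : V → ℝ) :
    lovasz F w = ∫ α, F (superlevel w α) := rfl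

theorem measurable_comp_superlevel (F : Finset V → ℝ) (w : V → ℝ) :
    Measurable fun α => F (superlevel w α) := by
  let _ : MeasurableSpace (Finset V) := ⊤
  have hanti : Antitone (superlevel w) := fun α β hαβ k => by
    simpa only [mem_superlevel] using hαβ.trans
  have hfiber (A : Finset V) : MeasurableSet (superlevel w ⁻¹' {A}) :=
    (Set.ordConnected_singleton.preimage_anti hanti).measurableSet
  exact measurable_from_top.comp (measurable_to_countable' hfiber)

theorem integrable_comp_superlevel (hempty : F ∅ = 0) (huniv : F Finset.univ = 0) (w : V → ℝ) :
    Integrable fun α => F (superlevel w α) := by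
  obtain ⟨a, ha⟩ := (Set.finite_range w).bddBelow
  obtain ⟨b, hb⟩ := (Set.finite_range w).bddAbove
  obtain ⟨c, hc⟩ := (Set.finite_range fun A => ‖F A‖).bddAbove
  have hsupport : Function.support (fun α => F (superlevel w α)) ⊆ Set.Icc a b := by
    intro α hα
    by_contra hαab
    obtain hαa | hbα := not_and_or.1 hαab
    · have : superlevel w α = Finset.univ := by
        ext k
        simpa using (not_le.1 hαa).le.trans (ha ⟨k, rfl⟩)
      exact hα (by simp only [this, huniv])
    · have : superlevel w α = ∅ := by
        ext k
        simpa using (hb ⟨k, rfl⟩).trans_lt (not_le.1 hbα)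
      exact hα (by simp only [this, hempty])
  refine (integrableOn_iff_integrable_of_support_subset hsupport).1 ?_
  exact Measure.integrableOn_of_bounded measure_Icc_lt_top.ne
    (measurable_comp_superlevel F w).aestronglyMeasurable
    (Filter.Eventually.of_forall fun α => hc ⟨superlevel w α, rfl⟩)

theorem lovasz_sub (hF : F ∅ = 0) (hF' : F Finset.univ = 0) (hG : G ∅ = 0)
    (hG' : G Finset.univ = 0) (w : V → ℝ) : lovasz (F - G) w = lovasz F w - lovasz G w :=
  integral_sub (integrable_comp_superlevel hF hF' w) (integrable_comp_superlevel hG hG' w)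

theorem lovasz_sum {s : V → ℝ} (hs : ∑ k, s k = 0) (w : V → ℝ) :
    lovasz (fun A => ∑ k ∈ A, s k) w = s ⬝ᵥ w := by
  obtain ⟨a, ha⟩ := (Set.finite_range w).bddBelow
  have hle (k : V) : a ≤ w k := ha ⟨k, rfl⟩
  have hindicator (α : ℝ) : ∑ k ∈ superlevel w α, s k =
      ∑ k, (Set.Ioc a (w k)).indicator (fun _ => s k) α := by
    by_cases hα : a < α
    · simp [superlevel, Finset.sum_filter, Set.indicator_apply, hα]
    · have hαw (k : V) : α ≤ w k := (not_lt.1 hα).trans (hle k)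
      simp [superlevel, hα, hαw, hs]
  calc lovasz (fun A => ∑ k ∈ A, s k) w
      = ∫ α, ∑ k, (Set.Ioc a (w k)).indicator (fun _ => s k) α :=
        integral_congr_ae (Filter.Eventually.of_forall hindicator)
    _ = ∑ k, ∫ α, (Set.Ioc a (w k)).indicator (fun _ => s k) α :=
        integral_finsetSum _ fun k _ =>
          (integrable_indicator_iff measurableSet_Ioc).2 (integrableOn_const measure_Ioc_lt_top.ne)
    _ = ∑ k, (w k - a) * s k := by simp [integral_indicator, hle]
    _ = w ⬝ᵥ s := by
        simp only [sub_mul, Finset.sum_sub_distrib, ← Finset.mul_sum, hs, mul_zero, sub_zero,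
          dotProduct]
    _ = s ⬝ᵥ w := dotProduct_comm w s

theorem lovasz_nonneg (hF : ∀ A, 0 ≤ F A) (w : V → ℝ) : 0 ≤ lovasz F w :=
  integral_nonneg fun _ => hF _

theorem lovasz_eq_zero_iff (hempty : F ∅ = 0) (huniv : F Finset.univ = 0) (hF : ∀ A, 0 ≤ F A)
    {w : V → ℝ} : lovasz F w = 0 ↔ ∀ α, F (superlevel w α) = 0 := by
  rw [lovasz_eq_integral_superlevel, integral_eq_zero_iff_of_nonneg (fun _ => hF _)
    (integrable_comp_superlevel hempty huniv w)]
  refine ⟨fun hae α => ?_, fun h => Filter.Eventually.of_forall h⟩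
  -- The integrand is left-continuous, hence it vanishes everywhere as soon as it does almost
  -- everywhere.
  obtain ⟨a, ha, hconst⟩ :=
    (mem_nhdsLE_iff_exists_Ioc_subset (a := α)).1 (eventually_superlevel_eq w α)
  obtain ⟨β, hβ, haβ, hβα⟩ := (Measure.dense_of_ae hae).exists_between ha
  have hβ' : F (superlevel w β) = 0 := hβ
  have hαβ : superlevel w β = superlevel w α := hconst ⟨haβ, hβα.le⟩
  rwa [← hαβ]

theorem lovasz_smul (F : Finset V → ℝ) (w : V → ℝ) {c : ℝ} (hc : 0 < c) :
    lovasz F (c • w) = c * lovasz F w := by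
  have hsuper (α : ℝ) : superlevel (c • w) α = superlevel w (α / c) := by
    ext k
    simp [div_le_iff₀' hc]
  simp only [lovasz_eq_integral_superlevel, hsuper]
  rw [Measure.integral_comp_div (fun α => F (superlevel w α)), abs_of_pos hc, smul_eq_mul]

theorem lovasz_zero (F : Finset V → ℝ) : lovasz F 0 = 0 := by
  have h := lovasz_smul F 0 two_pos
  rw [smul_zero] at h
  linarith

end Lovasz

section BasePolytope

variable {V : Type*} {F : Finset V → ℝ} {s w : V → ℝ}

/-- The sets on which the modular function `A ↦ ∑ k ∈ A, s k` agrees with `F`. -/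
def tightSets (F : Finset V → ℝ) (s : V → ℝ) : Set (Finset V) :=
  {A | ∑ k ∈ A, s k = F A}

theorem empty_mem_tightSets (hempty : F ∅ = 0) : ∅ ∈ tightSets F s :=
  Finset.sum_empty.trans hempty.symm

variable [Fintype V]

/-- The base polytope of `F`: the modular functions below `F` that agree with it on the full
set. For submodular `F`, the Lovász extension is its support function. -/
def basePolytope (F : Finset V → ℝ) : Set (V → ℝ) :=
  {s | (∀ A : Finset V, ∑ k ∈ A, s k ≤ F A) ∧ Finset.univ ∈ tightSets F s}

/-- The face of the base polytope on which the linear form `w` attains the Lovász extension. -/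
def maximizers (F : Finset V → ℝ) (w : V → ℝ) : Set (V → ℝ) :=
  {s ∈ basePolytope F | s ⬝ᵥ w = lovasz F w}

theorem lovasz_slack (hempty : F ∅ = 0) (huniv : F Finset.univ = 0) (hs : s ∈ basePolytope F)
    (w : V → ℝ) : lovasz (F - fun A => ∑ k ∈ A, s k) w = lovasz F w - s ⬝ᵥ w := by
  have hsum : ∑ k, s k = 0 := hs.2.trans huniv
  rw [lovasz_sub hempty huniv Finset.sum_empty hsum, lovasz_sum hsum]

theorem dotProduct_le_lovasz (hempty : F ∅ = 0) (huniv : F Finset.univ = 0)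
    (hs : s ∈ basePolytope F) (w : V → ℝ) : s ⬝ᵥ w ≤ lovasz F w := by
  rw [← sub_nonneg, ← lovasz_slack hempty huniv hs]
  exact lovasz_nonneg (fun A => sub_nonneg.2 (hs.1 A)) w

theorem mem_maximizers_iff (hempty : F ∅ = 0) (huniv : F Finset.univ = 0) :
    s ∈ maximizers F w ↔ s ∈ basePolytope F ∧ ∀ α, superlevel w α ∈ tightSets F s := by
  refine and_congr_right fun hs => ?_
  rw [eq_comm, ← sub_eq_zero, ← lovasz_slack hempty huniv hs, lovasz_eq_zero_iff
    (by simp [hempty]) (sub_eq_zero.2 hs.2.symm) (F := F - _) fun A => sub_nonneg.2 (hs.1 A)]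
  exact forall_congr' fun α => sub_eq_zero.trans eq_comm

theorem maximizers_subset_of_lt (hempty : F ∅ = 0) (huniv : F Finset.univ = 0) {u x : V → ℝ}
    (h : ∀ i j, u i < u j → x i < x j) : maximizers F x ⊆ maximizers F u := by
  intro s hs
  rw [mem_maximizers_iff hempty huniv] at hs ⊢
  refine ⟨hs.1, fun α => ?_⟩
  obtain hα | ⟨β, hβ⟩ := eq_empty_or_exists_eq_superlevel (w := x) (A := superlevel u α)
    fun i hi j hj => h j i (lt_of_mem_superlevel hi hj)
  · exact hα ▸ empty_mem_tightSets hempty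
  · exact hβ ▸ hs.2 β

variable [DecidableEq V]

theorem isModularOn_tightSets (hsub : IsSubmodular F) (hs : s ∈ basePolytope F) :
    IsModularOn F (tightSets F s) := by
  intro A hA B hB
  refine le_antisymm ?_ (hsub A B)
  rw [← hA, ← hB, ← Finset.sum_union_inter]
  exact add_le_add (hs.1 _) (hs.1 _)

theorem isSetLattice_tightSets (hsub : IsSubmodular F) (hempty : F ∅ = 0)
    (hs : s ∈ basePolytope F) : IsSetLattice (tightSets F s) := by
  have htight {A B : Finset V} (hA : A ∈ tightSets F s) (hB : B ∈ tightSets F s) :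
      ∑ k ∈ A ∪ B, s k = F (A ∪ B) ∧ ∑ k ∈ A ∩ B, s k = F (A ∩ B) := by
    refine (add_eq_add_iff_eq_and_eq (hs.1 _) (hs.1 _)).1 ?_
    rw [Finset.sum_union_inter, ← isModularOn_tightSets hsub hs A hA B hB, hA, hB]
  exact ⟨empty_mem_tightSets hempty, hs.2, fun A hA B hB => (htight hA hB).1,
    fun A hA B hB => (htight hA hB).2⟩

theorem mem_tightSets_of_union_of_inter (hs : s ∈ basePolytope F) {A B : Finset V}
    (hmod : F A + F B = F (A ∪ B) + F (A ∩ B)) (hunion : A ∪ B ∈ tightSets F s)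
    (hinter : A ∩ B ∈ tightSets F s) : A ∈ tightSets F s := by
  refine ((add_eq_add_iff_eq_and_eq (hs.1 A) (hs.1 B)).1 ?_).1
  rw [← Finset.sum_union_inter, hunion, hinter, hmod]

end BasePolytope

section Greedy

variable {V R : Type*} [Fintype V] [LinearOrder R]

/-- The greedy point of the base polytope: the increments of `F` along the chain of superlevel
sets of `w`. It is meaningful when `w` is injective, so that each step adds a single element. -/
def greedy (F : Finset V → ℝ) (w : V → R) (k : V) : ℝ :=
  F (superlevel w (w k)) - F (strictSuperlevel w (w k))

variable {F : Finset V → ℝ} {w : V → R}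

theorem insert_strictSuperlevel [DecidableEq V] (hw : w.Injective) (k : V) :
    insert k (strictSuperlevel w (w k)) = superlevel w (w k) := by
  ext j
  simp [le_iff_eq_or_lt, hw.eq_iff, eq_comm]

theorem superlevel_mem_tightSets_greedy (hempty : F ∅ = 0) (hw : w.Injective) (α : R) :
    superlevel w α ∈ tightSets F (greedy F w) := by
  classical
  refine superlevel_induction (P := fun A => ∑ j ∈ A, greedy F w j = F A)
    (empty_mem_tightSets hempty) (fun k ih => ?_) α
  rw [← insert_strictSuperlevel hw, Finset.sum_insert (by simp), ih, greedy,
    insert_strictSuperlevel hw, sub_add_cancel]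

variable [DecidableEq V]

theorem sum_greedy_le (hsub : IsSubmodular F) (hempty : F ∅ = 0) (hw : w.Injective)
    (A : Finset V) : ∑ k ∈ A, greedy F w k ≤ F A := by
  induction A using Finset.induction_on_min_value w with
  | empty => simp [hempty]
  | insert a A ha hmin ih =>
    have hsubset : A ⊆ strictSuperlevel w (w a) := fun x hx =>
      mem_strictSuperlevel.2 ((hmin x hx).lt_of_ne fun heq => ha (hw heq ▸ hx))
    have hunion : insert a A ∪ strictSuperlevel w (w a) = superlevel w (w a) := by
      rw [Finset.insert_union, Finset.union_eq_right.2 hsubset, insert_strictSuperlevel hw]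
    have hinter : insert a A ∩ strictSuperlevel w (w a) = A := by
      rw [Finset.insert_inter_of_notMem (by simp), Finset.inter_eq_left.2 hsubset]
    have hsub' := hsub (insert a A) (strictSuperlevel w (w a))
    rw [hunion, hinter] at hsub'
    rw [Finset.sum_insert ha, greedy]
    linarith

theorem greedy_mem_maximizers (hsub : IsSubmodular F) (hempty : F ∅ = 0)
    (huniv : F Finset.univ = 0) {w : V → ℝ} (hw : w.Injective) : greedy F w ∈ maximizers F w := by
  have htight (α : ℝ) : superlevel w α ∈ tightSets F (greedy F w) :=
    superlevel_mem_tightSets_greedy hempty hw α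
  obtain ⟨a, ha⟩ := exists_superlevel_eq_univ w
  exact (mem_maximizers_iff hempty huniv).2
    ⟨⟨sum_greedy_le hsub hempty hw, ha ▸ htight a⟩, htight⟩

theorem exists_injective_forall_lt {V : Type*} [Finite V] (w : V → ℝ) :
    ∃ x : V → ℝ, x.Injective ∧ ∀ i j, w i < w j → x i < x j := by
  obtain ⟨n, ⟨e⟩⟩ := Finite.exists_equiv_fin V
  obtain ⟨ε, hε, hlt⟩ := exists_pos_add_smul_lt w fun k => (e k : ℝ)
  refine ⟨_, fun i j hij => ?_, hlt⟩
  have hw : w i = w j := le_antisymm (not_lt.1 fun h => (hlt j i h).ne' hij)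
    (not_lt.1 fun h => (hlt i j h).ne hij)
  simpa [hw, hε.ne', Fin.val_inj] using hij

theorem maximizers_nonempty (hsub : IsSubmodular F) (hempty : F ∅ = 0)
    (huniv : F Finset.univ = 0) (w : V → ℝ) : (maximizers F w).Nonempty := by
  obtain ⟨x, hx, hlt⟩ := exists_injective_forall_lt w
  exact ⟨greedy F x, maximizers_subset_of_lt hempty huniv hlt
    (greedy_mem_maximizers hsub hempty huniv hx)⟩

theorem exists_mem_maximizers_mem_tightSets (hsub : IsSubmodular F) (hempty : F ∅ = 0)
    (huniv : F Finset.univ = 0) {w : V → ℝ} {α : ℝ} {A : Finset V}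
    (hstrict : strictSuperlevel w α ⊆ A) (hA : A ⊆ superlevel w α) :
    ∃ s ∈ maximizers F w, A ∈ tightSets F s := by
  -- Raising `w` slightly on `A` turns `A` into a superlevel set.
  obtain ⟨ε, hε, hlt⟩ := exists_pos_add_smul_lt w fun k => if k ∈ A then 1 else 0
  set x : V → ℝ := w + ε • fun k => if k ∈ A then 1 else 0 with hx
  obtain ⟨s, hs⟩ := maximizers_nonempty hsub hempty huniv x
  refine ⟨s, maximizers_subset_of_lt hempty huniv hlt hs, ?_⟩
  have hupper : ∀ i ∈ A, ∀ j ∉ A, x j < x i := by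
    intro i hi j hj
    have hwj : w j ≤ α := not_lt.1 fun h => hj (hstrict (mem_strictSuperlevel.2 h))
    have hwi : α ≤ w i := mem_superlevel.1 (hA hi)
    simp only [hx, Pi.add_apply, Pi.smul_apply, hi, hj, if_true, if_false, smul_eq_mul]
    linarith
  obtain hA | ⟨β, hβ⟩ := eq_empty_or_exists_eq_superlevel hupper
  · exact hA ▸ empty_mem_tightSets hempty
  · exact hβ ▸ ((mem_maximizers_iff hempty huniv).1 hs).2 β

end Greedy

section UnitBall

variable {V : Type*} [Fintype V]

theorem zero_mem_unitBall (F : Finset V → ℝ) : 0 ∈ unitBall F :=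
  (lovasz_zero F).trans_le zero_le_one

variable [DecidableEq V] {F : Finset V → ℝ}

theorem lovasz_add_le (hsub : IsSubmodular F) (hempty : F ∅ = 0) (huniv : F Finset.univ = 0)
    (x y : V → ℝ) : lovasz F (x + y) ≤ lovasz F x + lovasz F y := by
  obtain ⟨s, hs, hmax⟩ := maximizers_nonempty hsub hempty huniv (x + y)
  rw [← hmax, dotProduct_add]
  exact add_le_add (dotProduct_le_lovasz hempty huniv hs x) (dotProduct_le_lovasz hempty huniv hs y)

theorem convex_unitBall (hsub : IsSubmodular F) (hempty : F ∅ = 0) (huniv : F Finset.univ = 0) :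
    Convex ℝ (unitBall F) := by
  refine convex_iff_forall_pos.2 fun x hx y hy a b ha hb hab => ?_
  calc lovasz F (a • x + b • y)
      ≤ lovasz F (a • x) + lovasz F (b • y) := lovasz_add_le hsub hempty huniv _ _
    _ = a * lovasz F x + b * lovasz F y := by rw [lovasz_smul F x ha, lovasz_smul F y hb]
    _ ≤ a * 1 + b * 1 := by gcongr <;> assumption
    _ = 1 := by rw [mul_one, mul_one, hab]

theorem minimalFace_unitBall_of_lt_one (hsub : IsSubmodular F) (hempty : F ∅ = 0)
    (huniv : F Finset.univ = 0) {w : V → ℝ} (hw : lovasz F w < 1) :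
    minimalFace (unitBall F) w = unitBall F := by
  refine Set.Subset.antisymm (fun u hu => hu.1) fun u hu => ⟨hu, ?_⟩
  have htendsto : Filter.Tendsto (fun ε : ℝ => lovasz F w + ε * lovasz F (w - u)) (𝓝[>] 0)
      (𝓝 (lovasz F w)) := by
    have : Continuous fun ε : ℝ => lovasz F w + ε * lovasz F (w - u) := by fun_prop
    simpa using (this.tendsto 0).mono_left nhdsWithin_le_nhds
  obtain ⟨ε, hlt, hε⟩ := ((htendsto.eventually_lt_const hw).and self_mem_nhdsWithin).exists
  refine ⟨ε, hε, ?_⟩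
  calc lovasz F (w + ε • (w - u))
      ≤ lovasz F w + lovasz F (ε • (w - u)) := lovasz_add_le hsub hempty huniv _ _
    _ = lovasz F w + ε * lovasz F (w - u) := by rw [lovasz_smul F _ hε]
    _ ≤ 1 := hlt.le

theorem mem_minimalFace_unitBall_iff (hsub : IsSubmodular F) (hempty : F ∅ = 0)
    (huniv : F Finset.univ = 0) {w u : V → ℝ} (hw : lovasz F w = 1) :
    u ∈ minimalFace (unitBall F) w ↔ lovasz F u = 1 ∧ maximizers F w ⊆ maximizers F u := by
  constructor
  · rintro ⟨hu, ε, hε, hq⟩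
    have hdot {s : V → ℝ} (hs : s ∈ maximizers F w) : 1 ≤ s ⬝ᵥ u := by
      have hle : s ⬝ᵥ (w + ε • (w - u)) ≤ 1 := (dotProduct_le_lovasz hempty huniv hs.1 _).trans hq
      rw [dotProduct_add, dotProduct_smul, dotProduct_sub, hs.2, hw, smul_eq_mul] at hle
      nlinarith
    obtain ⟨s, hs⟩ := maximizers_nonempty hsub hempty huniv w
    have hu1 : lovasz F u = 1 :=
      le_antisymm hu ((hdot hs).trans (dotProduct_le_lovasz hempty huniv hs.1 u))
    exact ⟨hu1, fun t ht => ⟨ht.1,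
      le_antisymm (dotProduct_le_lovasz hempty huniv ht.1 u) (hu1.trans_le (hdot ht))⟩⟩
  · rintro ⟨hu, hmax⟩
    obtain ⟨ε, hε, hlt⟩ := exists_pos_add_smul_lt w (w - u)
    obtain ⟨s, hs⟩ := maximizers_nonempty hsub hempty huniv (w + ε • (w - u))
    have hsw : s ∈ maximizers F w := maximizers_subset_of_lt hempty huniv hlt hs
    refine ⟨hu.le, ε, hε, ?_⟩
    calc lovasz F (w + ε • (w - u))
        = s ⬝ᵥ w + ε * (s ⬝ᵥ w - s ⬝ᵥ u) := by
          rw [← hs.2, dotProduct_add, dotProduct_smul, dotProduct_sub, smul_eq_mul]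
      _ = 1 := by rw [hsw.2, (hmax hsw).2, hw, hu, sub_self, mul_zero, add_zero]
      _ ≤ 1 := le_rfl

theorem minimalFace_unitBall_ne (hsub : IsSubmodular F) (hempty : F ∅ = 0)
    (huniv : F Finset.univ = 0) {w : V → ℝ} (hw : lovasz F w = 1) :
    minimalFace (unitBall F) w ≠ unitBall F := by
  intro heq
  have h0 : (0 : V → ℝ) ∈ minimalFace (unitBall F) w := heq.superset (zero_mem_unitBall F)
  have h1 := ((mem_minimalFace_unitBall_iff hsub hempty huniv hw).1 h0).1
  exact zero_ne_one ((lovasz_zero F).symm.trans h1)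

theorem minimalFace_unitBall_eq_iff (hsub : IsSubmodular F) (hempty : F ∅ = 0)
    (huniv : F Finset.univ = 0) {w u : V → ℝ} (hw : lovasz F w = 1) :
    u ∈ unitBall F ∧ minimalFace (unitBall F) u = minimalFace (unitBall F) w ↔
      lovasz F u = 1 ∧ maximizers F u = maximizers F w := by
  have hmem {u v : V → ℝ} (hu : lovasz F u = 1) :=
    mem_minimalFace_unitBall_iff hsub hempty huniv hu (u := v)
  constructor
  · rintro ⟨hu, heq⟩
    obtain ⟨hu1, hwu⟩ := (hmem hw).1 (heq.subset (self_mem_minimalFace hu))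
    obtain ⟨-, huw⟩ := (hmem hu1).1 (heq.superset (self_mem_minimalFace hw.le))
    exact ⟨hu1, huw.antisymm hwu⟩
  · rintro ⟨hu, heq⟩
    refine ⟨hu.le, Set.ext fun v => ?_⟩
    rw [hmem hu, hmem hw, heq]

theorem setOf_intrinsicInterior_proper_face_unitBall_eq (hsub : IsSubmodular F)
    (hempty : F ∅ = 0) (huniv : F Finset.univ = 0) :
    {R : Set (V → ℝ) | R.Nonempty ∧
        ∃ G, IsFace (unitBall F) G ∧ G ≠ unitBall F ∧ R = intrinsicInterior ℝ G} =
      {R | ∃ w, lovasz F w = 1 ∧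
        R = {u | lovasz F u = 1 ∧ maximizers F u = maximizers F w}} := by
  refine (setOf_intrinsicInterior_proper_face_eq (convex_unitBall hsub hempty huniv)).trans ?_
  ext R
  refine exists_congr fun w => ⟨?_, ?_⟩
  · rintro ⟨hw, hne, rfl⟩
    have hw1 : lovasz F w = 1 := le_antisymm hw
      (not_lt.1 fun hlt => hne (minimalFace_unitBall_of_lt_one hsub hempty huniv hlt))
    exact ⟨hw1, Set.ext fun u => minimalFace_unitBall_eq_iff hsub hempty huniv hw1⟩
  · rintro ⟨hw, rfl⟩
    exact ⟨hw.le, minimalFace_unitBall_ne hsub hempty huniv hw,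
      Set.ext fun u => (minimalFace_unitBall_eq_iff hsub hempty huniv hw).symm⟩

theorem intrinsicInterior_unitBall (hsub : IsSubmodular F) (hempty : F ∅ = 0)
    (huniv : F Finset.univ = 0) : intrinsicInterior ℝ (unitBall F) = {w | lovasz F w < 1} := by
  ext w
  rw [mem_intrinsicInterior_iff_minimalFace_eq (convex_unitBall hsub hempty huniv)]
  constructor
  · rintro ⟨hw, heq⟩
    exact lt_of_le_of_ne hw fun hw1 => minimalFace_unitBall_ne hsub hempty huniv hw1 heq
  · intro (hw : lovasz F w < 1)
    exact ⟨hw.le, minimalFace_unitBall_of_lt_one hsub hempty huniv hw⟩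

end UnitBall

section SetLattice

variable {V : Type*} [Fintype V] {D D' : Set (Finset V)} {j k : V}

open Classical in
/-- The elements that belong to every member of `D` containing `j`. When `D` is a lattice, this is
its smallest member that contains `j`. -/
noncomputable def lowerHull (D : Set (Finset V)) (j : V) : Finset V :=
  Finset.univ.filter fun k => ∀ T ∈ D, j ∈ T → k ∈ T

open Classical in
/-- The elements that no member of `D` separates from `j`. When `D` is a lattice, this is the
block of `D` that contains `j`. -/
noncomputable def blockOf (D : Set (Finset V)) (j : V) : Finset V :=
  Finset.univ.filter fun k => ∀ T ∈ D, j ∈ T ↔ k ∈ T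

theorem mem_lowerHull : k ∈ lowerHull D j ↔ ∀ T ∈ D, j ∈ T → k ∈ T := by
  simp [lowerHull]

theorem mem_blockOf : k ∈ blockOf D j ↔ ∀ T ∈ D, j ∈ T ↔ k ∈ T := by
  simp [blockOf]

theorem mem_blockOf_iff_mem_lowerHull :
    k ∈ blockOf D j ↔ k ∈ lowerHull D j ∧ j ∈ lowerHull D k := by
  simp only [mem_blockOf, mem_lowerHull, iff_iff_implies_and_implies, forall_and]

theorem self_mem_lowerHull (D : Set (Finset V)) (j : V) : j ∈ lowerHull D j :=
  mem_lowerHull.2 fun _ _ => id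

theorem self_mem_blockOf (D : Set (Finset V)) (j : V) : j ∈ blockOf D j :=
  mem_blockOf.2 fun _ _ => Iff.rfl

theorem lowerHull_subset {T : Finset V} (hT : T ∈ D) (hj : j ∈ T) : lowerHull D j ⊆ T :=
  fun _ hk => mem_lowerHull.1 hk T hT hj

theorem blockOf_subset_lowerHull (D : Set (Finset V)) (j : V) : blockOf D j ⊆ lowerHull D j :=
  fun _ hk => (mem_blockOf_iff_mem_lowerHull.1 hk).1

theorem blockOf_subset {T : Finset V} (hT : T ∈ D) (hj : j ∈ T) : blockOf D j ⊆ T :=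
  (blockOf_subset_lowerHull D j).trans (lowerHull_subset hT hj)

theorem blockOf_eq_of_mem (h : k ∈ blockOf D j) : blockOf D k = blockOf D j := by
  rw [mem_blockOf] at h
  ext i
  rw [mem_blockOf, mem_blockOf]
  exact forall₂_congr fun T hT => by rw [h T hT]

variable [DecidableEq V]

theorem mem_lowerHull_sdiff_blockOf :
    k ∈ lowerHull D j \ blockOf D j ↔ k ∈ lowerHull D j ∧ j ∉ lowerHull D k := by
  rw [Finset.mem_sdiff, mem_blockOf_iff_mem_lowerHull]
  tauto

namespace IsSetLattice

theorem lowerHull_mem (hD : IsSetLattice D) (j : V) : lowerHull D j ∈ D := by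
  classical
  have heq : lowerHull D j = (Finset.univ.filter fun T => T ∈ D ∧ j ∈ T).inf id := by
    refine le_antisymm (Finset.le_inf fun T hT => ?_) fun k hk => mem_lowerHull.2 fun T hT hj => ?_
    · simp only [Finset.mem_filter, Finset.mem_univ, true_and] at hT
      exact lowerHull_subset hT.1 hT.2
    · have hle : (Finset.univ.filter fun T => T ∈ D ∧ j ∈ T).inf id ≤ T :=
        Finset.inf_le (f := id) (by simp [hT, hj])
      exact hle hk
  rw [heq]
  exact Finset.inf_induction (p := (· ∈ D)) hD.univ_mem hD.inter_mem
    fun T hT => (Finset.mem_filter.1 hT).2.1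

theorem mem_of_lowerHull_subset (hD : IsSetLattice D) {T : Finset V}
    (h : ∀ j ∈ T, lowerHull D j ⊆ T) : T ∈ D := by
  have hT : T = T.sup (lowerHull D) :=
    le_antisymm (fun j hj => Finset.mem_sup.2 ⟨j, hj, self_mem_lowerHull D j⟩) (Finset.sup_le h)
  rw [hT]
  exact Finset.sup_induction (p := (· ∈ D)) hD.empty_mem hD.union_mem
    fun j _ => hD.lowerHull_mem j

theorem lowerHull_subset_lowerHull (hD : IsSetLattice D) (h : k ∈ lowerHull D j) :
    lowerHull D k ⊆ lowerHull D j :=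
  lowerHull_subset (hD.lowerHull_mem j) h

theorem lowerHull_sdiff_blockOf_mem (hD : IsSetLattice D) (j : V) :
    lowerHull D j \ blockOf D j ∈ D := by
  refine hD.mem_of_lowerHull_subset fun i hi k hk => ?_
  rw [mem_lowerHull_sdiff_blockOf] at hi ⊢
  exact ⟨hD.lowerHull_subset_lowerHull hi.1 hk,
    fun hj => hi.2 (hD.lowerHull_subset_lowerHull hk hj)⟩

theorem blockOf_mem_blocks (hD : IsSetLattice D) (j : V) : blockOf D j ∈ blocks D := by
  refine ⟨lowerHull D j \ blockOf D j, hD.lowerHull_sdiff_blockOf_mem j, lowerHull D j,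
    hD.lowerHull_mem j, ?_, ?_, (sdiff_sdiff_eq_self (blockOf_subset_lowerHull D j)).symm⟩
  · exact (Finset.ssubset_iff_of_subset Finset.sdiff_subset).2
      ⟨j, self_mem_lowerHull D j, by simp [self_mem_blockOf]⟩
  · rintro R hR ⟨hsub, hssub⟩
    obtain ⟨k, hkR, hk⟩ := Finset.exists_of_ssubset hsub
    have hkj : k ∈ blockOf D j := by
      by_contra hkj
      exact hk (Finset.mem_sdiff.2 ⟨hssub.1 hkR, hkj⟩)
    exact hssub.2 (lowerHull_subset hR ((mem_blockOf.1 hkj R hR).2 hkR))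

theorem subset_of_covering (hD : IsSetLattice D) {R S T : Finset V} (hR : R ∈ D) (hS : S ∈ D)
    (hT : T ∈ D) (hST : S ⊆ T) (hcov : ∀ Q ∈ D, ¬ (S ⊂ Q ∧ Q ⊂ T)) (hj : j ∈ T \ S)
    (hjR : j ∈ R) : T \ S ⊆ R := by
  -- The member `S ∪ (R ∩ T)` lies between `S` and `T`, and is not `S`.
  have hmem : S ∪ R ∩ T ∈ D := hD.union_mem S hS _ (hD.inter_mem R hR T hT)
  rw [Finset.mem_sdiff] at hj
  have hlt : S ⊂ S ∪ R ∩ T :=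
    (Finset.ssubset_iff_of_subset Finset.subset_union_left).2 ⟨j, by simp [hj.1, hjR], hj.2⟩
  have hle : S ∪ R ∩ T ⊆ T := Finset.union_subset hST Finset.inter_subset_right
  have heq : S ∪ R ∩ T = T := hle.eq_of_not_ssubset fun h => hcov _ hmem ⟨hlt, h⟩
  intro k hk
  rw [Finset.mem_sdiff, ← heq, Finset.mem_union, Finset.mem_inter] at hk
  tauto

theorem exists_blockOf_eq (hD : IsSetLattice D) {A : Finset V} (hA : A ∈ blocks D) :
    ∃ j, blockOf D j = A := by
  obtain ⟨S, hS, T, hT, hST, hcov, rfl⟩ := hA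
  obtain ⟨j, hj⟩ := Finset.sdiff_nonempty.2 hST.2
  refine ⟨j, Finset.Subset.antisymm (fun k hk => ?_) fun k hk => mem_blockOf.2 fun R hR => ?_⟩
  · rw [mem_blockOf] at hk
    rwa [Finset.mem_sdiff, ← hk T hT, ← hk S hS, ← Finset.mem_sdiff]
  · exact ⟨fun hjR => hD.subset_of_covering hR hS hT hST.1 hcov hj hjR hk,
      fun hkR => hD.subset_of_covering hR hS hT hST.1 hcov hk hkR hj⟩

theorem blocks_eq_range (hD : IsSetLattice D) : blocks D = Set.range (blockOf D) :=
  Set.Subset.antisymm (fun _ hA => hD.exists_blockOf_eq hA)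
    (Set.range_subset_iff.2 hD.blockOf_mem_blocks)

theorem isAncestor_blockOf_iff (hD : IsSetLattice D) :
    IsAncestor D (blockOf D k) (blockOf D j) ↔ k ∈ lowerHull D j \ blockOf D j := by
  rw [Finset.mem_sdiff]
  constructor
  · rintro ⟨-, -, hne, h⟩
    have hkj : blockOf D k ⊆ lowerHull D j :=
      h _ (hD.lowerHull_mem j) (blockOf_subset_lowerHull D j)
    exact ⟨hkj (self_mem_blockOf D k), fun hk => hne (blockOf_eq_of_mem hk)⟩
  · rintro ⟨hk, hkj⟩
    refine ⟨hD.blockOf_mem_blocks k, hD.blockOf_mem_blocks j,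
      fun h => hkj (h ▸ self_mem_blockOf D k), fun T hT hj => blockOf_subset hT ?_⟩
    exact mem_lowerHull.1 hk T hT (hj (self_mem_blockOf D j))

theorem ancestorUnion_blockOf (hD : IsSetLattice D) (j : V) :
    ancestorUnion D (blockOf D j) = lowerHull D j \ blockOf D j := by
  ext k
  simp only [ancestorUnion, Finset.mem_filter, Finset.mem_univ, true_and]
  constructor
  · rintro ⟨A, hA, hk⟩
    obtain ⟨i, rfl⟩ := hD.exists_blockOf_eq hA.1
    rwa [← blockOf_eq_of_mem hk, hD.isAncestor_blockOf_iff] at hA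
  · exact fun h => ⟨blockOf D k, hD.isAncestor_blockOf_iff.2 h, self_mem_blockOf D k⟩

theorem blockOf_eq_of_blocks_eq (hD : IsSetLattice D) (hD' : IsSetLattice D')
    (h : blocks D = blocks D') (j : V) : blockOf D j = blockOf D' j := by
  obtain ⟨i, hi⟩ := hD'.exists_blockOf_eq (h ▸ hD.blockOf_mem_blocks j)
  rw [← hi]
  exact (blockOf_eq_of_mem (hi.symm ▸ self_mem_blockOf D j)).symm

end IsSetLattice

end SetLattice

section OpenCone

variable {V : Type*} [Fintype V] [DecidableEq V] {D D' : Set (Finset V)} {w : V → ℝ} {j : V}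

namespace IsSetLattice

theorem mem_openCone_iff (hD : IsSetLattice D) :
    w ∈ openCone D ↔ ∀ j, (∀ k ∈ blockOf D j, w k = w j) ∧
      ∀ k ∈ lowerHull D j \ blockOf D j, w j < w k := by
  constructor
  · rintro ⟨v, hconst, hlt⟩ j
    have hv (i : V) {k : V} (hk : k ∈ blockOf D i) : w k = v (blockOf D i) :=
      hconst _ (hD.blockOf_mem_blocks i) k hk
    refine ⟨fun k hk => (hv j hk).trans (hv j (self_mem_blockOf D j)).symm, fun k hk => ?_⟩
    rw [hv j (self_mem_blockOf D j), hv k (self_mem_blockOf D k)]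
    exact hlt _ _ (hD.isAncestor_blockOf_iff.2 hk)
  · intro h
    classical
    let v (A : Finset V) : ℝ := if hA : A.Nonempty then w hA.choose else 0
    have hv (j : V) : v (blockOf D j) = w j := by
      have hne : (blockOf D j).Nonempty := ⟨j, self_mem_blockOf D j⟩
      simpa only [v, dif_pos hne] using (h j).1 _ hne.choose_spec
    refine ⟨v, fun A hA k hk => ?_, fun A' A hA => ?_⟩
    · obtain ⟨j, rfl⟩ := hD.exists_blockOf_eq hA
      rw [hv, (h j).1 k hk]
    · obtain ⟨k, rfl⟩ := hD.exists_blockOf_eq hA.1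
      obtain ⟨j, rfl⟩ := hD.exists_blockOf_eq hA.2.1
      rw [hv, hv]
      exact (h j).2 k (hD.isAncestor_blockOf_iff.1 hA)

theorem lowerHull_subset_superlevel (hD : IsSetLattice D) (hw : w ∈ openCone D) (j : V) :
    lowerHull D j ⊆ superlevel w (w j) := by
  intro k hk
  rw [hD.mem_openCone_iff] at hw
  by_cases hkj : k ∈ blockOf D j
  · exact mem_superlevel.2 ((hw j).1 k hkj).ge
  · exact mem_superlevel.2 ((hw j).2 k (Finset.mem_sdiff.2 ⟨hk, hkj⟩)).le

theorem superlevel_mem (hD : IsSetLattice D) (hw : w ∈ openCone D) (α : ℝ) :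
    superlevel w α ∈ D := by
  refine hD.mem_of_lowerHull_subset fun j hj k hk => ?_
  have hjk := mem_superlevel.1 (hD.lowerHull_subset_superlevel hw j hk)
  exact mem_superlevel.2 ((mem_superlevel.1 hj).trans hjk)

theorem strictSuperlevel_union_mem (hD : IsSetLattice D) (hw : w ∈ openCone D) {α : ℝ}
    {A : Finset V} (hA : A ⊆ superlevel w α) (hblock : ∀ j ∈ A, blockOf D j ⊆ A) :
    strictSuperlevel w α ∪ A ∈ D := by
  refine hD.mem_of_lowerHull_subset fun j hj k hk => ?_
  rw [Finset.mem_union, mem_strictSuperlevel] at hj ⊢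
  have hjk : w j ≤ w k := mem_superlevel.1 (hD.lowerHull_subset_superlevel hw j hk)
  obtain hj | hj := hj
  · exact Or.inl (hj.trans_le hjk)
  by_cases hkj : k ∈ blockOf D j
  · exact Or.inr (hblock j hj hkj)
  · exact Or.inl ((mem_superlevel.1 (hA hj)).trans_lt
      ((hD.mem_openCone_iff.1 hw j).2 k (Finset.mem_sdiff.2 ⟨hk, hkj⟩)))

theorem strictSuperlevel_mem (hD : IsSetLattice D) (hw : w ∈ openCone D) (α : ℝ) :
    strictSuperlevel w α ∈ D := by
  simpa using hD.strictSuperlevel_union_mem hw (A := ∅) (α := α) (by simp) (by simp)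

theorem strictSuperlevel_union_blockOf_mem (hD : IsSetLattice D) (hw : w ∈ openCone D) (j : V) :
    strictSuperlevel w (w j) ∪ blockOf D j ∈ D :=
  hD.strictSuperlevel_union_mem hw
    ((blockOf_subset_lowerHull D j).trans (hD.lowerHull_subset_superlevel hw j))
    fun _ hk => (blockOf_eq_of_mem hk).subset

theorem disjoint_strictSuperlevel_blockOf (hD : IsSetLattice D) (hw : w ∈ openCone D) (j : V) :
    Disjoint (strictSuperlevel w (w j)) (blockOf D j) := by
  refine Finset.disjoint_left.2 fun k hk hkj => ?_
  exact (mem_strictSuperlevel.1 hk).ne' (((hD.mem_openCone_iff.1 hw) j).1 k hkj)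

theorem lowerHull_sdiff_blockOf_subset (hD : IsSetLattice D) (hw : w ∈ openCone D) (j : V) :
    lowerHull D j \ blockOf D j ⊆ strictSuperlevel w (w j) :=
  fun k hk => mem_strictSuperlevel.2 (((hD.mem_openCone_iff.1 hw) j).2 k hk)

theorem smul_mem_openCone (hD : IsSetLattice D) (hw : w ∈ openCone D) {c : ℝ} (hc : 0 < c) :
    c • w ∈ openCone D := by
  rw [hD.mem_openCone_iff] at hw ⊢
  refine fun j => ⟨fun k hk => ?_, fun k hk => ?_⟩
  · simp only [Pi.smul_apply, (hw j).1 k hk]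
  · simpa using mul_lt_mul_of_pos_left ((hw j).2 k hk) hc

theorem openCone_nonempty (hD : IsSetLattice D) : (openCone D).Nonempty := by
  classical
  -- Minus the size of the lower hull is strictly larger on the ancestors of a block.
  refine ⟨fun k => -((lowerHull D k).card : ℝ), hD.mem_openCone_iff.2 fun j => ⟨?_, ?_⟩⟩
  · intro k hk
    obtain ⟨hkj, hjk⟩ := mem_blockOf_iff_mem_lowerHull.1 hk
    simp only [(hD.lowerHull_subset_lowerHull hkj).antisymm (hD.lowerHull_subset_lowerHull hjk)]
  · intro k hk
    obtain ⟨hkj, hjk⟩ := mem_lowerHull_sdiff_blockOf.1 hk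
    rw [neg_lt_neg_iff, Nat.cast_lt]
    exact Finset.card_lt_card ((Finset.ssubset_iff_of_subset
      (hD.lowerHull_subset_lowerHull hkj)).2 ⟨j, self_mem_lowerHull D j, hjk⟩)

theorem openCone_subset_of_blocks_eq (hD : IsSetLattice D) (hD' : IsSetLattice D')
    (h : blocks D = blocks D') (hsub : D ⊆ D') : openCone D ⊆ openCone D' := by
  intro w hw
  rw [hD.mem_openCone_iff] at hw
  rw [hD'.mem_openCone_iff]
  intro j
  rw [← hD.blockOf_eq_of_blocks_eq hD' h]
  refine ⟨(hw j).1, fun k hk => (hw j).2 k (Finset.sdiff_subset_sdiff ?_ subset_rfl hk)⟩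
  exact fun i hi => mem_lowerHull.2 fun T hT => mem_lowerHull.1 hi T (hsub hT)

end IsSetLattice

end OpenCone

section Contraction

variable {V : Type*} [DecidableEq V] {F : Finset V → ℝ} {A B C L : Finset V}

/-- The contraction of `F` by `B`, the set-function for which the blocks of a lattice are required
to be inseparable. -/
def contraction (F : Finset V → ℝ) (B C : Finset V) : ℝ :=
  F (B ∪ C) - F B

theorem contraction_eq_of_subset (hsub : IsSubmodular F) (hBL : B ⊆ L) (hdisj : Disjoint L A)
    (h : contraction F B A = contraction F L A) (hC : C ⊆ A) :
    contraction F B C = contraction F L C := by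
  rw [Finset.disjoint_left] at hdisj
  have hunion : B ∪ C ∪ L = L ∪ C := by grind
  have hinter : (B ∪ C) ∩ L = B := by grind
  have hunion' : B ∪ A ∪ (L ∪ C) = L ∪ A := by grind
  have hinter' : (B ∪ A) ∩ (L ∪ C) = B ∪ C := by grind
  have hBC := hsub (B ∪ C) L
  have hBA := hsub (B ∪ A) (L ∪ C)
  rw [hunion, hinter] at hBC
  rw [hunion', hinter'] at hBA
  simp only [contraction] at h ⊢
  linarith

theorem isInseparable_congr {H H' : Finset V → ℝ} (h : ∀ C ⊆ A, H C = H' C) :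
    IsInseparable H A ↔ IsInseparable H' A := by
  refine not_congr (exists₂_congr fun B C => ?_)
  constructor <;> rintro ⟨hB, hC, hdisj, rfl, hsep⟩ <;> refine ⟨hB, hC, hdisj, rfl, ?_⟩ <;>
    simpa only [h _ subset_rfl, h _ Finset.subset_union_left, h _ Finset.subset_union_right]
      using hsep

variable [Fintype V] {D : Set (Finset V)} {w : V → ℝ}

theorem IsSetLattice.hasInseparableBlocks_iff_lowerHull (hD : IsSetLattice D) :
    HasInseparableBlocks F D ↔
      ∀ j, IsInseparable (contraction F (lowerHull D j \ blockOf D j)) (blockOf D j) := by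
  rw [HasInseparableBlocks, hD.blocks_eq_range, Set.forall_mem_range]
  simp only [hD.ancestorUnion_blockOf]
  rfl

theorem IsSetLattice.hasInseparableBlocks_iff (hD : IsSetLattice D) (hsub : IsSubmodular F)
    (hmod : IsModularOn F D) (hw : w ∈ openCone D) :
    HasInseparableBlocks F D ↔
      ∀ j, IsInseparable (contraction F (strictSuperlevel w (w j))) (blockOf D j) := by
  refine hD.hasInseparableBlocks_iff_lowerHull.trans
    (forall_congr' fun j => isInseparable_congr fun C hC => ?_)
  have hdisj := hD.disjoint_strictSuperlevel_blockOf hw j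
  have hlt := hD.lowerHull_sdiff_blockOf_subset hw j
  have hle := blockOf_subset_lowerHull D j
  refine contraction_eq_of_subset hsub hlt hdisj ?_ hC
  have hsum := hmod _ (hD.lowerHull_mem j) _ (hD.strictSuperlevel_mem hw (w j))
  have hunion : lowerHull D j ∪ strictSuperlevel w (w j) =
      strictSuperlevel w (w j) ∪ blockOf D j := by
    rw [← Finset.sdiff_union_of_subset hle, Finset.union_right_comm, Finset.union_eq_right.2 hlt]
  have hinter : lowerHull D j ∩ strictSuperlevel w (w j) = lowerHull D j \ blockOf D j := by
    grind [Finset.disjoint_left.1 hdisj]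
  rw [hunion, hinter] at hsum
  rw [contraction, contraction, Finset.sdiff_union_of_subset hle]
  linarith

end Contraction

section TightLattice

variable {V : Type*} [Fintype V] {F : Finset V → ℝ} {D : Set (Finset V)} {w u : V → ℝ} {α : ℝ}
  {A T : Finset V}

/-- The sets that are tight for every point of the base polytope at which `w` is maximal. As `w`
runs through `{f = 1}`, these are the lattices that describe the faces of the unit ball. -/
def tightLattice (F : Finset V → ℝ) (w : V → ℝ) : Set (Finset V) :=
  {A | ∀ s ∈ maximizers F w, A ∈ tightSets F s}

theorem superlevel_mem_tightLattice (hempty : F ∅ = 0) (huniv : F Finset.univ = 0) (w : V → ℝ)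
    (α : ℝ) : superlevel w α ∈ tightLattice F w :=
  fun _ hs => ((mem_maximizers_iff hempty huniv).1 hs).2 α

theorem strictSuperlevel_mem_tightLattice (hempty : F ∅ = 0) (huniv : F Finset.univ = 0)
    (w : V → ℝ) (α : ℝ) : strictSuperlevel w α ∈ tightLattice F w := by
  obtain hα | ⟨β, hβ⟩ := eq_empty_or_exists_eq_superlevel (w := w) (A := strictSuperlevel w α)
    fun _ hi _ hj => lt_of_mem_strictSuperlevel hi hj
  · exact hα ▸ fun _ _ => empty_mem_tightSets hempty
  · exact hβ ▸ superlevel_mem_tightLattice hempty huniv w β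

variable [DecidableEq V]

theorem isSetLattice_tightLattice (hsub : IsSubmodular F) (hempty : F ∅ = 0) (w : V → ℝ) :
    IsSetLattice (tightLattice F w) := by
  have hlattice {s : V → ℝ} (hs : s ∈ maximizers F w) : IsSetLattice (tightSets F s) :=
    isSetLattice_tightSets hsub hempty hs.1
  exact ⟨fun s hs => (hlattice hs).empty_mem, fun s hs => (hlattice hs).univ_mem,
    fun A hA B hB s hs => (hlattice hs).union_mem A (hA s hs) B (hB s hs),
    fun A hA B hB s hs => (hlattice hs).inter_mem A (hA s hs) B (hB s hs)⟩

theorem isModularOn_tightLattice (hsub : IsSubmodular F) (hempty : F ∅ = 0)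
    (huniv : F Finset.univ = 0) (w : V → ℝ) : IsModularOn F (tightLattice F w) := by
  obtain ⟨s, hs⟩ := maximizers_nonempty hsub hempty huniv w
  exact fun A hA B hB => isModularOn_tightSets hsub hs.1 A (hA s hs) B (hB s hs)

theorem strictSuperlevel_union_sdiff_mem_tightLattice (hsub : IsSubmodular F) (hempty : F ∅ = 0)
    (huniv : F Finset.univ = 0) (hA : A ⊆ superlevel w α)
    (hLA : strictSuperlevel w α ∪ A ∈ tightLattice F w) (hT : T ∈ tightLattice F w) :
    strictSuperlevel w α ∪ A \ T ∈ tightLattice F w := by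
  set L := strictSuperlevel w α
  have hlattice := isSetLattice_tightLattice hsub hempty w
  have hLw : L ∈ tightLattice F w := strictSuperlevel_mem_tightLattice hempty huniv w α
  have hcompl : L ∪ A ∩ T ∈ tightLattice F w := by
    rw [Finset.union_inter_distrib_left]
    exact hlattice.inter_mem _ hLA _ (hlattice.union_mem _ hLw _ hT)
  have hunion : (L ∪ A \ T) ∪ (L ∪ A ∩ T) = L ∪ A := by grind
  have hinter : (L ∪ A \ T) ∩ (L ∪ A ∩ T) = L := by grind
  -- Modularity on the pair holds because a single maximizer is tight on both sets.
  have hmod : F (L ∪ A \ T) + F (L ∪ A ∩ T) = F (L ∪ A) + F L := by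
    obtain ⟨s, hs, htight⟩ := exists_mem_maximizers_mem_tightSets hsub hempty huniv
      (w := w) (α := α) (A := L ∪ A \ T) Finset.subset_union_left
      (Finset.union_subset strictSuperlevel_subset_superlevel (Finset.sdiff_subset.trans hA))
    have := isModularOn_tightSets hsub hs.1 _ htight _ (hcompl s hs)
    rwa [hunion, hinter] at this
  intro s hs
  exact mem_tightSets_of_union_of_inter hs.1 (by rw [hmod, hunion, hinter])
    (hunion.symm ▸ hLA s hs) (hinter.symm ▸ hLw s hs)

theorem mem_openCone_tightLattice (hsub : IsSubmodular F) (hempty : F ∅ = 0)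
    (huniv : F Finset.univ = 0) (w : V → ℝ) : w ∈ openCone (tightLattice F w) := by
  have hle {i k : V} (hk : k ∈ lowerHull (tightLattice F w) i) : w i ≤ w k :=
    mem_superlevel.1 (lowerHull_subset (superlevel_mem_tightLattice hempty huniv w (w i))
      (mem_superlevel.2 le_rfl) hk)
  refine (isSetLattice_tightLattice hsub hempty w).mem_openCone_iff.2 fun j =>
    ⟨fun k hk => ?_, fun k hk => ?_⟩
  · obtain ⟨hkj, hjk⟩ := mem_blockOf_iff_mem_lowerHull.1 hk
    exact le_antisymm (hle hjk) (hle hkj)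
  · obtain ⟨hkj, hjk⟩ := mem_lowerHull_sdiff_blockOf.1 hk
    refine (hle hkj).lt_of_ne fun heq => ?_
    simp only [mem_lowerHull, not_forall] at hjk
    obtain ⟨T, hT, hkT, hjT⟩ := hjk
    -- If `w k = w j`, the part of the level of `j` outside `T` separates `j` from `k`.
    have hmem : strictSuperlevel w (w j) ∪ superlevel w (w j) \ T ∈ tightLattice F w :=
      strictSuperlevel_union_sdiff_mem_tightLattice hsub hempty huniv subset_rfl
        (by rw [Finset.union_eq_right.2 strictSuperlevel_subset_superlevel]
            exact superlevel_mem_tightLattice hempty huniv w (w j)) hT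
    have hk' := mem_lowerHull.1 hkj _ hmem (by simp [hjT])
    simp [hkT, heq] at hk'

theorem inter_superlevel_mem_tightSets (hempty : F ∅ = 0) (huniv : F Finset.univ = 0)
    (hD : IsSetLattice D) (hmod : IsModularOn F D) (hw : w ∈ openCone D) (hT : T ∈ D) {s : V → ℝ}
    (hs : s ∈ maximizers F w) (α : ℝ) : T ∩ superlevel w α ∈ tightSets F s := by
  obtain ⟨hbase, htight⟩ := (mem_maximizers_iff hempty huniv).1 hs
  refine superlevel_induction (P := fun L => T ∩ L ∈ tightSets F s)
    (by simpa only [Finset.inter_empty] using empty_mem_tightSets hempty) (fun i ih => ?_) α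
  set L := superlevel w (w i)
  set L' := strictSuperlevel w (w i)
  have hLD : L ∈ D := hD.superlevel_mem hw (w i)
  have hLD' : L' ∈ D := hD.strictSuperlevel_mem hw (w i)
  have hle : L' ⊆ L := strictSuperlevel_subset_superlevel
  have hTL : T ∩ L ∈ D := hD.inter_mem T hT L hLD
  have hX : L' ∪ T ∩ L ∈ D := hD.union_mem L' hLD' _ hTL
  have hX' : L' ∪ L \ T ∈ D := by
    refine hD.strictSuperlevel_union_mem hw Finset.sdiff_subset fun j hj k hk => ?_
    rw [mem_blockOf] at hk
    rwa [Finset.mem_sdiff, ← hk T hT, ← hk L hLD, ← Finset.mem_sdiff]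
  have htight' : L' ∈ tightSets F s := strictSuperlevel_mem_tightLattice hempty huniv w (w i) s hs
  have hXtight : L' ∪ T ∩ L ∈ tightSets F s := by
    have hunion : (L' ∪ T ∩ L) ∪ (L' ∪ L \ T) = L := by grind
    have hinter : (L' ∪ T ∩ L) ∩ (L' ∪ L \ T) = L' := by grind
    exact mem_tightSets_of_union_of_inter hbase (hmod _ hX _ hX') (hunion.symm ▸ htight (w i))
      (hinter.symm ▸ htight')
  have hunion : T ∩ L ∪ L' = L' ∪ T ∩ L := Finset.union_comm _ _
  have hinter : T ∩ L ∩ L' = T ∩ L' := by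
    rw [Finset.inter_assoc, Finset.inter_eq_right.2 hle]
  exact mem_tightSets_of_union_of_inter hbase (hmod _ hTL _ hLD') (hunion.symm ▸ hXtight)
    (hinter.symm ▸ ih)

theorem subset_tightLattice (hempty : F ∅ = 0) (huniv : F Finset.univ = 0) (hD : IsSetLattice D)
    (hmod : IsModularOn F D) (hw : w ∈ openCone D) : D ⊆ tightLattice F w := by
  intro T hT s hs
  obtain ⟨a, ha⟩ := exists_superlevel_eq_univ w
  rw [← Finset.inter_univ T, ← ha]
  exact inter_superlevel_mem_tightSets hempty huniv hD hmod hw hT hs a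

theorem mem_openCone_tightLattice_iff (hsub : IsSubmodular F) (hempty : F ∅ = 0)
    (huniv : F Finset.univ = 0) :
    u ∈ openCone (tightLattice F w) ↔ maximizers F u = maximizers F w := by
  refine ⟨fun hu => ?_, fun h => ?_⟩
  · have hlattice := isSetLattice_tightLattice hsub hempty w
    have hmod := isModularOn_tightLattice hsub hempty huniv w
    have hle := subset_tightLattice hempty huniv hlattice hmod hu
    refine Set.Subset.antisymm (fun s hs => ?_) fun s hs => ?_
    · exact (mem_maximizers_iff hempty huniv).2
        ⟨hs.1, fun α => hle (superlevel_mem_tightLattice hempty huniv w α) s hs⟩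
    · exact (mem_maximizers_iff hempty huniv).2
        ⟨hs.1, fun α => hlattice.superlevel_mem hu α s hs⟩
  · rw [show tightLattice F w = tightLattice F u by simp only [tightLattice, h]]
    exact mem_openCone_tightLattice hsub hempty huniv u

theorem hasInseparableBlocks_tightLattice (hsub : IsSubmodular F) (hempty : F ∅ = 0)
    (huniv : F Finset.univ = 0) (w : V → ℝ) : HasInseparableBlocks F (tightLattice F w) := by
  have hlattice := isSetLattice_tightLattice hsub hempty w
  have hw := mem_openCone_tightLattice hsub hempty huniv w
  refine (hlattice.hasInseparableBlocks_iff hsub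
    (isModularOn_tightLattice hsub hempty huniv w) hw).2 fun j => ?_
  rintro ⟨B, C, ⟨b, hb⟩, ⟨c, hc⟩, hdisj, hunion, hsep⟩
  set L := strictSuperlevel w (w j)
  have hLA := hlattice.strictSuperlevel_union_blockOf_mem hw j
  have hLdisj := Finset.disjoint_left.1 (hlattice.disjoint_strictSuperlevel_blockOf hw j)
  rw [← hunion] at hLA hLdisj
  have hBtight : L ∪ B ∈ tightLattice F w := by
    intro s hs
    have hLB : (L ∪ B) ∪ (L ∪ C) = L ∪ (B ∪ C) := by grind
    have hLC : (L ∪ B) ∩ (L ∪ C) = L := by grind [Finset.disjoint_left.1 hdisj]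
    refine mem_tightSets_of_union_of_inter hs.1 (B := L ∪ C) ?_ (hLB.symm ▸ hLA s hs)
      (hLC.symm ▸ strictSuperlevel_mem_tightLattice hempty huniv w (w j) s hs)
    rw [← hunion] at hsep
    simp only [contraction] at hsep
    rw [hLB, hLC]
    linarith
  -- The tight set `L ∪ B` cuts the block.
  have hbj : b ∈ blockOf (tightLattice F w) j := hunion ▸ Finset.mem_union_left C hb
  have hcj : c ∈ blockOf (tightLattice F w) j := hunion ▸ Finset.mem_union_right B hc
  have hcL : c ∈ L ∪ B :=
    ((mem_blockOf.1 hbj _ hBtight).symm.trans (mem_blockOf.1 hcj _ hBtight)).1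
      (Finset.mem_union_right L hb)
  grind [Finset.disjoint_left.1 hdisj]

theorem isAllowedLattice_tightLattice (hsub : IsSubmodular F) (hempty : F ∅ = 0)
    (huniv : F Finset.univ = 0) (w : V → ℝ) : IsAllowedLattice F (tightLattice F w) where
  isSetLattice := isSetLattice_tightLattice hsub hempty w
  modular := isModularOn_tightLattice hsub hempty huniv w
  inseparable := hasInseparableBlocks_tightLattice hsub hempty huniv w
  maximal D hD hblocks hmod _ hle := by
    have hw := (isSetLattice_tightLattice hsub hempty w).openCone_subset_of_blocks_eq hD
      hblocks.symm hle (mem_openCone_tightLattice hsub hempty huniv w)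
    exact (subset_tightLattice hempty huniv hD hmod hw).antisymm hle

theorem disjoint_or_subset_of_mem_tightLattice (hsub : IsSubmodular F) (hempty : F ∅ = 0)
    (huniv : F Finset.univ = 0) (hA : A ⊆ superlevel w α)
    (hLA : strictSuperlevel w α ∪ A ∈ tightLattice F w)
    (hinsep : IsInseparable (contraction F (strictSuperlevel w α)) A)
    (hT : T ∈ tightLattice F w) : Disjoint A T ∨ A ⊆ T := by
  by_contra! hcut
  rw [Finset.not_disjoint_iff_nonempty_inter, ← Finset.sdiff_nonempty] at hcut
  refine hinsep ⟨A ∩ T, A \ T, hcut.1, hcut.2, (Finset.disjoint_sdiff_inter A T).symm,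
    by rw [Finset.union_comm, Finset.sdiff_union_inter], ?_⟩
  set L := strictSuperlevel w α
  have hlattice := isSetLattice_tightLattice hsub hempty w
  have hinter_mem : L ∪ A ∩ T ∈ tightLattice F w := by
    rw [Finset.union_inter_distrib_left]
    exact hlattice.inter_mem _ hLA _
      (hlattice.union_mem _ (strictSuperlevel_mem_tightLattice hempty huniv w α) _ hT)
  have hmod := isModularOn_tightLattice hsub hempty huniv w _ hinter_mem _
    (strictSuperlevel_union_sdiff_mem_tightLattice hsub hempty huniv hA hLA hT)
  have hunion : (L ∪ A ∩ T) ∪ (L ∪ A \ T) = L ∪ A := by grind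
  have hinter : (L ∪ A ∩ T) ∩ (L ∪ A \ T) = L := by grind
  rw [hunion, hinter] at hmod
  simp only [contraction]
  linarith

theorem blockOf_tightLattice_eq (hsub : IsSubmodular F) (hempty : F ∅ = 0)
    (huniv : F Finset.univ = 0) (hD : IsSetLattice D) (hmod : IsModularOn F D)
    (hinsep : HasInseparableBlocks F D) (hw : w ∈ openCone D) (j : V) :
    blockOf (tightLattice F w) j = blockOf D j := by
  have hle : D ⊆ tightLattice F w := subset_tightLattice hempty huniv hD hmod hw
  refine Finset.Subset.antisymm (fun k hk => mem_blockOf.2 fun T hT => mem_blockOf.1 hk T (hle hT))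
    fun k hk => mem_blockOf.2 fun T hT => ?_
  have hdisj_or_subset := disjoint_or_subset_of_mem_tightLattice hsub hempty huniv
    ((blockOf_subset_lowerHull D j).trans (hD.lowerHull_subset_superlevel hw j))
    (hle (hD.strictSuperlevel_union_blockOf_mem hw j))
    ((hD.hasInseparableBlocks_iff hsub hmod hw).1 hinsep j) hT
  obtain hdisj | hsubset := hdisj_or_subset
  · rw [Finset.disjoint_left] at hdisj
    exact iff_of_false (hdisj (self_mem_blockOf D j)) (hdisj hk)
  · exact iff_of_true (hsubset (self_mem_blockOf D j)) (hsubset hk)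

theorem tightLattice_eq (hsub : IsSubmodular F) (hempty : F ∅ = 0) (huniv : F Finset.univ = 0)
    (hD : IsAllowedLattice F D) (hw : w ∈ openCone D) : tightLattice F w = D := by
  have hlattice := isSetLattice_tightLattice hsub hempty w
  refine hD.maximal _ hlattice ?_ (isModularOn_tightLattice hsub hempty huniv w)
    (hasInseparableBlocks_tightLattice hsub hempty huniv w)
    (subset_tightLattice hempty huniv hD.isSetLattice hD.modular hw)
  rw [hlattice.blocks_eq_range, hD.isSetLattice.blocks_eq_range]
  exact congrArg Set.range (funext
    (blockOf_tightLattice_eq hsub hempty huniv hD.isSetLattice hD.modular hD.inseparable hw))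

theorem lovasz_eq_zero_iff_of_mem_openCone (hempty : F ∅ = 0) (huniv : F Finset.univ = 0)
    (hF : ∀ A, 0 ≤ F A) (hD : IsSetLattice D) (hmod : IsModularOn F D) (hw : w ∈ openCone D) :
    lovasz F w = 0 ↔ ∀ T ∈ D, F T = 0 := by
  constructor
  · intro h0 T hT
    have hmax : 0 ∈ maximizers F w := by
      refine ⟨⟨fun A => ?_, ?_⟩, by rw [zero_dotProduct, h0]⟩
      · simpa using hF A
      · simpa [tightSets] using huniv.symm
    have htight := subset_tightLattice hempty huniv hD hmod hw hT 0 hmax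
    simpa [tightSets] using htight.symm
  · exact fun h => (lovasz_eq_zero_iff hempty huniv hF).2 fun α => h _ (hD.superlevel_mem hw α)

theorem openCone_inter_nonempty_iff (hempty : F ∅ = 0) (huniv : F Finset.univ = 0)
    (hF : ∀ A, 0 ≤ F A) (hD : IsSetLattice D) (hmod : IsModularOn F D) :
    (openCone D ∩ {w | lovasz F w = 1}).Nonempty ↔ ∃ T ∈ D, F T ≠ 0 := by
  have hzero {w : V → ℝ} (hw : w ∈ openCone D) : lovasz F w ≠ 0 ↔ ∃ T ∈ D, F T ≠ 0 := by
    simpa using (lovasz_eq_zero_iff_of_mem_openCone hempty huniv hF hD hmod hw).not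
  constructor
  · rintro ⟨w, hw, hw1 : lovasz F w = 1⟩
    exact (hzero hw).1 (hw1.trans_ne one_ne_zero)
  · intro hne
    obtain ⟨w, hw⟩ := hD.openCone_nonempty
    have hpos : 0 < lovasz F w := (lovasz_nonneg hF w).lt_of_ne' ((hzero hw).2 hne)
    refine ⟨(lovasz F w)⁻¹ • w, hD.smul_mem_openCone hw (inv_pos.2 hpos), ?_⟩
    exact (lovasz_smul F w (inv_pos.2 hpos)).trans (inv_mul_cancel₀ hpos.ne')

theorem openCone_inter_nonempty_iff_ne (hempty : F ∅ = 0) (huniv : F Finset.univ = 0)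
    (hpos : ∀ A : Finset V, A ≠ ∅ → A ≠ Finset.univ → 0 < F A) (hD : IsSetLattice D)
    (hmod : IsModularOn F D) :
    (openCone D ∩ {w | lovasz F w = 1}).Nonempty ↔ D ≠ {∅, Finset.univ} := by
  have hF (A : Finset V) : 0 ≤ F A ∧ (F A ≠ 0 ↔ A ∉ ({∅, Finset.univ} : Set (Finset V))) := by
    by_cases hA : A = ∅
    · simp [hA, hempty]
    by_cases hA' : A = Finset.univ
    · simp [hA', huniv]
    · simp [hA, hA', (hpos A hA hA').le, (hpos A hA hA').ne']
  rw [openCone_inter_nonempty_iff hempty huniv (fun A => (hF A).1) hD hmod]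
  simp only [(hF _).2]
  rw [← Set.not_subset, Ne, Set.Subset.antisymm_iff,
    and_iff_left (Set.pair_subset hD.empty_mem hD.univ_mem)]

end TightLattice

theorem proposition3_general {V : Type*} [Fintype V] [DecidableEq V] {F : Finset V → ℝ}
    (hsub : IsSubmodular F) (hempty : F ∅ = 0) (huniv : F Finset.univ = 0) :
    {R : Set (V → ℝ) | R.Nonempty ∧
        ∃ G, IsFace (unitBall F) G ∧ G ≠ unitBall F ∧ R = intrinsicInterior ℝ G} =
      {R : Set (V → ℝ) |
        ∃ D, IsAllowedLattice F D ∧ (openCone D ∩ {w | lovasz F w = 1}).Nonempty ∧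
          R = openCone D ∩ {w | lovasz F w = 1}} ∧
    intrinsicInterior ℝ (unitBall F) = {w | lovasz F w < 1} := by
  refine ⟨?_, intrinsicInterior_unitBall hsub hempty huniv⟩
  have hcone (w : V → ℝ) : {u | lovasz F u = 1 ∧ maximizers F u = maximizers F w} =
      openCone (tightLattice F w) ∩ {u | lovasz F u = 1} := by
    ext u
    exact and_comm.trans (and_congr_left'
      (mem_openCone_tightLattice_iff hsub hempty huniv).symm)
  rw [setOf_intrinsicInterior_proper_face_unitBall_eq hsub hempty huniv]
  simp only [hcone]
  ext R
  constructor
  · rintro ⟨w, hw, rfl⟩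
    exact ⟨tightLattice F w, isAllowedLattice_tightLattice hsub hempty huniv w,
      ⟨w, mem_openCone_tightLattice hsub hempty huniv w, hw⟩, rfl⟩
  · rintro ⟨D, hD, ⟨w, hwD, hw⟩, rfl⟩
    exact ⟨w, hw, by rw [tightLattice_eq hsub hempty huniv hD hwD]⟩

theorem proposition3 (p : ℕ) (F : Finset (Fin p) → ℝ)
    (hsub : IsSubmodular F) (hempty : F ∅ = 0) (huniv : F Finset.univ = 0)
    (hpos : ∀ A : Finset (Fin p), A ≠ ∅ → A ≠ Finset.univ → 0 < F A) :
    {R : Set (Fin p → ℝ) | R.Nonempty ∧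
        ∃ G, IsFace (unitBall F) G ∧ G ≠ unitBall F ∧ R = intrinsicInterior ℝ G} =
      {R : Set (Fin p → ℝ) |
        ∃ D, IsAllowedLattice F D ∧ D ≠ {∅, Finset.univ} ∧
          R = openCone D ∩ {w | lovasz F w = 1}} ∧
    intrinsicInterior ℝ (unitBall F) = {w | lovasz F w < 1} := by
  obtain ⟨hfaces, hball⟩ := proposition3_general hsub hempty huniv
  refine ⟨hfaces.trans (Set.ext fun R => exists_congr fun D => and_congr_right fun hD => ?_), hball⟩
  rw [openCone_inter_nonempty_iff_ne hempty huniv hpos hD.isSetLattice hD.modular]
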